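/- Let $n\ge 0$ and let $A$ be a real (symmetric) positive definite matrix of size $2n\times 2n$. Let $J=\begin{bmatrix}0&I\\-I&0\end{bmatrix}$ ($n\times n$ blocks), and call a real $2n\times 2n$ matrix $M$ symplectic if $M^TJM=J$. By Williamson's theorem, for every such $A$ there are a symplectic $M$ and uniquely determined numbers $0<d_1(A)\le\cdots\le d_n(A)$, the symplectic eigenvalues of $A$, with $M^TAM=\begin{bmatrix}D&0\\0&D\end{bmatrix}$, $D=\operatorname{diag}(d_1(A),\dots,d_n(A))$. Let $\widehat d(A)=(d_n(A),d_n(A),\dots,d_1(A),d_1(A))\in\mathbb R^{2n}$ be the vector of symplectic eigenvalues, each counted twice, in decreasing order, and write $\widehat d^{\,t}(A)$ for the vector with coordinates $\widehat d_j(A)^t$. For vectors $x,y\in\mathbb R^m$ with positive coordinates, write $x\prec_{\log}y$ ($x$ is log majorised by $y$) if $$\prod_{j=1}^k x_j^{\downarrow}\le\prod_{j=1}^k y_j^{\downarrow}\quad(1\le k\le m)\qquad\text{and}\qquad \prod_{j=1}^m x_j^{\downarrow}=\prod_{j=1}^m y_j^{\downarrow},$$ where $x^{\downarrow}$ denotes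 $x$ with its coordinates rearranged in decreasing order. Let $A^t$ be the real power of $A$ given by the spectral theorem. Then $$\widehat d(A^t)\prec_{\log}\widehat d^{\,t}(A)\quad\text{for } 0\le t\le 1,\qquad\text{and}\qquad \widehat d^{\,t}(A)\prec_{\log}\widehat d(A^t)\quad\text{for } 1\le t<\infty .$$ -/

import Mathlib

noncomputable section

/-- `d` is the list `d₁ ≤ ⋯ ≤ dₙ` of symplectic eigenvalues of the `2n × 2n` matrix `A`: the `dⱼ`
are positive and `Mᵀ A M = diag (D, D)` with `D = diag (d₁, …, dₙ)`, for some real symplectic `M`.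
(Mathlib's `J` is the negative of `[0, I; -I, 0]`; both give the same symplectic group.) -/
def IsSymplecticEigenvalues {n : ℕ} (A : Matrix (Fin n ⊕ Fin n) (Fin n ⊕ Fin n) ℝ)
    (d : Fin n → ℝ) : Prop :=
  Monotone d ∧ (∀ j, 0 < d j) ∧
    ∃ M ∈ Matrix.symplecticGroup (Fin n) ℝ,
      M.transpose * A * M = Matrix.fromBlocks (Matrix.diagonal d) 0 0 (Matrix.diagonal d)

open Classical in
/-- The symplectic eigenvalues `d₁(A) ≤ ⋯ ≤ dₙ(A)`. By Williamson's theorem they exist and are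
unique for every positive definite `A`; for a matrix `A` without symplectic eigenvalues the value
is the zero vector. -/
def symplecticEigenvalues {n : ℕ} (A : Matrix (Fin n ⊕ Fin n) (Fin n ⊕ Fin n) ℝ) : Fin n → ℝ :=
  if h : ∃ d, IsSymplecticEigenvalues A d then h.choose else 0

/-- The `2n`-vector of symplectic eigenvalues, each counted twice, in decreasing order:
`(dₙ, dₙ, dₙ₋₁, dₙ₋₁, …, d₁, d₁)`. -/
def symplecticEigenvaluesHat {n : ℕ} (A : Matrix (Fin n ⊕ Fin n) (Fin n ⊕ Fin n) ℝ) :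
    Fin (2 * n) → ℝ :=
  fun j => symplecticEigenvalues A (Fin.rev ⟨j / 2, by omega⟩)

/-- The power `A ^ t` of a real positive definite matrix, by the functional calculus. -/
def matrixRpow {ι : Type*} [Fintype ι] [DecidableEq ι] (A : Matrix ι ι ℝ) (t : ℝ) :
    Matrix ι ι ℝ :=
  cfc (fun x : ℝ => x ^ t) A

/-- The coordinates of `x` rearranged in decreasing order. -/
def decreasingRearrangement {m : ℕ} (x : Fin m → ℝ) : Fin m → ℝ :=
  fun j => x (Tuple.sort x (Fin.rev j))

/-- Log majorisation `x ≺_log y`, a relation between vectors with positive coordinates. -/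
def LogMajorized {m : ℕ} (x y : Fin m → ℝ) : Prop :=
  (∀ j, 0 < x j) ∧ (∀ j, 0 < y j) ∧
    (∀ k : ℕ, 1 ≤ k → k ≤ m →
      ∏ j : Fin m with j.val < k, decreasingRearrangement x j ≤
        ∏ j : Fin m with j.val < k, decreasingRearrangement y j) ∧
    ∏ j : Fin m, decreasingRearrangement x j = ∏ j : Fin m, decreasingRearrangement y j

end

/-! Williamson's theorem makes the symplectic eigenvalues of `A`, each counted twice, the singular
values of `S J S` with `S = A^(1/2)`: an orthogonal `T` gives `S J S = T diag(d, d) J Tᵀ`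
(`IsSymplecticEigenvalues.exists_orthogonal`). The product of the `k` largest singular values is the
largest value of `|det (Wᴴ S J S V)|` over `W`, `V` with `k` orthonormal columns; the upper bound
comes from Cauchy–Binet (`norm_det_conjTranspose_mul_diagonal_mul_le`).

For `0 ≤ t ≤ 1`, choose `W` and `V` so that this determinant for `A^t` is the product to be bounded,
and keep them fixed in `z ↦ det (Wᴴ A^(z/2) J A^(z/2) V)`. On `Re z = 0` the powers are unitary and
the modulus is at most `1`. On `Re z = 1` they are unitary multiples of `A^(1/2)`, and the modulus
is at most the corresponding product `C` for `A`. The three lines theorem gives `C^t` at `z = t`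
(`IsSymplecticEigenvalues.prod_le_rpow`). The argument applies to any admissible `d`, so uniqueness
in Williamson's theorem plays no role.

Equality of the full products is `det (A^t) = (det A)^t`, since symplectic matrices have determinant
`1`. The case `t ≥ 1` follows from exponent `1/t` applied to `A^t`. -/

namespace Matrix

/-! ### Cauchy–Binet and bounds for minors -/

section CauchyBinet

variable {k N R : Type*} [Fintype k] [DecidableEq k] [Fintype N] [CommRing R]

/-- Each row of `A * B` is a combination of rows of `B`, and the determinant is multilinear in the
rows. -/
theorem det_mul_eq_sum_prod_mul_det_submatrix (A : Matrix k N R) (B : Matrix N k R) :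
    (A * B).det = ∑ f : k → N, (∏ i, A i (f i)) * (B.submatrix f id).det := by
  have h : (A * B) = fun i => ∑ x, A i x • B x := by
    ext i j
    simp [mul_apply, Finset.sum_apply]
  rw [h]
  change (detRowAlternating (n := k) (R := R)).toMultilinearMap (fun i => ∑ x, A i x • B x) = _
  rw [MultilinearMap.map_sum]
  refine Finset.sum_congr rfl fun f _ => ?_
  rw [MultilinearMap.map_smul_univ, smul_eq_mul]
  rfl

/-- The Cauchy–Binet formula, with each minor counted once for every enumeration of its index
set. -/
theorem factorial_mul_det_mul (A : Matrix k N R) (B : Matrix N k R) :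
    ((Fintype.card k).factorial : R) * (A * B).det =
      ∑ f : k → N, (A.submatrix id f).det * (B.submatrix f id).det := by
  -- Reindexing the sum by `σ` permutes the rows of the minor of `B` and produces a sign. Summing
  -- over all `σ` then assembles the Leibniz expansion of the minor of `A`.
  have key : ∀ σ : Equiv.Perm k, (A * B).det =
      ∑ f : k → N, ((Equiv.Perm.sign σ : ℤ) : R) * (∏ i, A i (f (σ i))) *
        (B.submatrix f id).det := by
    intro σ
    rw [det_mul_eq_sum_prod_mul_det_submatrix,
      ← Equiv.sum_comp (Equiv.arrowCongr σ.symm (Equiv.refl N))]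
    refine Finset.sum_congr rfl fun f _ => ?_
    have h2 := det_permute σ (B.submatrix f id)
    rw [submatrix_submatrix] at h2
    have h1 : (B.submatrix (Equiv.arrowCongr σ.symm (Equiv.refl N) f) id).det =
        ((Equiv.Perm.sign σ : ℤ) : R) * (B.submatrix f id).det := by
      rw [← h2]
      rfl
    rw [h1]
    simp only [Equiv.arrowCongr_apply, Function.comp, Equiv.symm_symm, Equiv.refl_apply]
    ring
  have hs : ∑ _σ : Equiv.Perm k, (A * B).det = ((Fintype.card k).factorial : R) * (A * B).det := by
    rw [Finset.sum_const, nsmul_eq_mul, Finset.card_univ, Fintype.card_perm]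
  rw [← hs, Finset.sum_congr rfl fun σ _ => key σ, Finset.sum_comm]
  refine Finset.sum_congr rfl fun f _ => ?_
  rw [← Finset.sum_mul, ← det_transpose (A.submatrix id f), det_apply' (A.submatrix id f)ᵀ]
  simp

end CauchyBinet

/-- If `W` and `V` have orthonormal columns, then `|det (Wᴴ diag(δ) V)|` is at most the largest
product of entries of `δ` with distinct indices. -/
theorem norm_det_conjTranspose_mul_diagonal_mul_le {k N : Type*} [Fintype k] [DecidableEq k]
    [Fintype N] [DecidableEq N] {δ : N → ℝ} {C : ℝ} (hδ : ∀ i, 0 ≤ δ i) (hC0 : 0 ≤ C)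
    (hC : ∀ f : k → N, Function.Injective f → ∏ i, δ (f i) ≤ C) {W V : Matrix N k ℂ}
    (hW : Wᴴ * W = 1) (hV : Vᴴ * V = 1) :
    ‖(Wᴴ * diagonal (fun i => (δ i : ℂ)) * V).det‖ ≤ C := by
  set c : ℝ := ((Fintype.card k).factorial : ℝ)
  have hc : 0 < c := by positivity
  -- Cauchy–Binet for `Xᴴ * X = 1`: the squared moduli of the minors, over all maps `f`, add up to
  -- `k!`.
  have norm_sum : ∀ X : Matrix N k ℂ, Xᴴ * X = 1 →
      ∑ f : k → N, ‖(X.submatrix f id).det‖ ^ 2 = c := by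
    intro X hX
    have h := factorial_mul_det_mul Xᴴ X
    rw [hX, det_one, mul_one] at h
    have h' : ((∑ f : k → N, ‖(X.submatrix f id).det‖ ^ 2 : ℝ) : ℂ) = (c : ℂ) := by
      rw [Complex.ofReal_sum]
      simp only [c, Complex.ofReal_natCast]
      rw [h]
      refine Finset.sum_congr rfl fun f _ => ?_
      have : Xᴴ.submatrix id f = (X.submatrix f id)ᴴ := rfl
      rw [this, det_conjTranspose, Complex.ofReal_pow]
      exact (Complex.conj_mul' _).symm
    exact_mod_cast h'
  have hexp := factorial_mul_det_mul (Wᴴ * diagonal (fun i => (δ i : ℂ))) V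
  -- For injective `f`, the inequality `ab ≤ (a² + b²) / 2` separates the two minors. Otherwise a
  -- repeated row makes the term vanish, so only products over distinct indices meet `C`.
  have hterm : ∀ f : k → N,
      ‖((Wᴴ * diagonal (fun i => (δ i : ℂ))).submatrix id f).det * (V.submatrix f id).det‖ ≤
        C * ((‖(W.submatrix f id).det‖ ^ 2 + ‖(V.submatrix f id).det‖ ^ 2) / 2) := by
    intro f
    by_cases hf : Function.Injective f
    · have h1 : (Wᴴ * diagonal (fun i => (δ i : ℂ))).submatrix id f =
          (W.submatrix f id)ᴴ * diagonal (fun i => (δ (f i) : ℂ)) := by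
        ext i j
        simp [mul_diagonal]
      have h2 : ‖∏ i, (δ (f i) : ℂ)‖ = ∏ i, δ (f i) := by
        rw [norm_prod]
        exact Finset.prod_congr rfl fun i _ => by simp [abs_of_nonneg (hδ (f i))]
      rw [h1, det_mul, det_diagonal, det_conjTranspose, norm_mul, norm_mul, h2, norm_star]
      have h3 : ‖(W.submatrix f id).det‖ * ‖(V.submatrix f id).det‖ ≤
          (‖(W.submatrix f id).det‖ ^ 2 + ‖(V.submatrix f id).det‖ ^ 2) / 2 := by
        nlinarith [sq_nonneg (‖(W.submatrix f id).det‖ - ‖(V.submatrix f id).det‖)]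
      calc _ = (∏ i, δ (f i)) * (‖(W.submatrix f id).det‖ * ‖(V.submatrix f id).det‖) := by ring
        _ ≤ _ := mul_le_mul (hC f hf) h3 (by positivity) hC0
    · have : (V.submatrix f id).det = 0 := by
        simp only [Function.Injective, not_forall] at hf
        obtain ⟨i, j, hij, hne⟩ := hf
        exact det_zero_of_row_eq hne (by ext; simp [hij])
      rw [this, mul_zero, norm_zero]
      positivity
  have h4 : c * ‖(Wᴴ * diagonal (fun i => (δ i : ℂ)) * V).det‖ ≤ c * C := by
    calc c * ‖(Wᴴ * diagonal (fun i => (δ i : ℂ)) * V).det‖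
        = ‖((Fintype.card k).factorial : ℂ) * (Wᴴ * diagonal (fun i => (δ i : ℂ)) * V).det‖ := by
          rw [norm_mul]; simp [c]
      _ ≤ ∑ f : k → N,
          C * ((‖(W.submatrix f id).det‖ ^ 2 + ‖(V.submatrix f id).det‖ ^ 2) / 2) := by
          rw [hexp]
          exact (norm_sum_le _ _).trans (Finset.sum_le_sum fun f _ => hterm f)
      _ = c * C := by
          rw [← Finset.mul_sum, ← Finset.sum_div, Finset.sum_add_distrib, norm_sum W hW,
            norm_sum V hV]
          ring
  exact le_of_mul_le_mul_left h4 hc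

end Matrix

/-! ### Orthogonal normal form of skew-symmetric operators -/

open Module in
/-- One step of the normal form of an injective skew-symmetric operator: an orthonormal family on
which the operator acts by rotations extends, as long as it does not span. -/
theorem exists_extend_rotation_family {E : Type*} [NormedAddCommGroup E] [InnerProductSpace ℝ E]
    [FiniteDimensional ℝ E] (K : E →ₗ[ℝ] E) (hK : ∀ x y, inner ℝ (K x) y = -inner ℝ x (K y))
    (hinj : Function.Injective K) {ι : Type*} [Fintype ι] (e f : ι → E) (c : ι → ℝ)
    (hef : ∀ i, K (e i) = c i • f i) (hfe : ∀ i, K (f i) = -(c i) • e i)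
    (hdim : 2 * Fintype.card ι < finrank ℝ E) :
    ∃ (u v : E) (s : ℝ), 0 < s ∧ K u = s • v ∧ K v = -s • u ∧ ‖u‖ = 1 ∧ ‖v‖ = 1 ∧
      inner ℝ u v = 0 ∧ (∀ i, inner ℝ (e i) u = 0) ∧ (∀ i, inner ℝ (f i) u = 0) ∧
      (∀ i, inner ℝ (e i) v = 0) ∧ (∀ i, inner ℝ (f i) v = 0) := by
  classical
  set S : Submodule ℝ E := Submodule.span ℝ (Set.range (Sum.elim e f)) with hS
  have hSdim : finrank ℝ S < finrank ℝ E := by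
    refine lt_of_le_of_lt (finrank_range_le_card (Sum.elim e f)) ?_
    rw [Fintype.card_sum]
    omega
  have hmem : ∀ x, x ∈ Sᗮ ↔ (∀ i, inner ℝ (e i) x = 0) ∧ (∀ i, inner ℝ (f i) x = 0) := by
    intro x
    constructor
    · intro hx
      rw [Submodule.mem_orthogonal] at hx
      exact ⟨fun i => hx _ (Submodule.subset_span ⟨Sum.inl i, rfl⟩),
        fun i => hx _ (Submodule.subset_span ⟨Sum.inr i, rfl⟩)⟩
    · rintro ⟨h1, h2⟩
      have hle : S ≤ (Submodule.span ℝ {x})ᗮ := by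
        rw [hS, Submodule.span_le]
        rintro _ ⟨i | i, rfl⟩
        · exact (Submodule.mem_orthogonal_singleton_iff_inner_left).2 (h1 i)
        · exact (Submodule.mem_orthogonal_singleton_iff_inner_left).2 (h2 i)
      rw [Submodule.mem_orthogonal]
      intro y hy
      exact (Submodule.mem_orthogonal_singleton_iff_inner_left).1 (hle hy)
  have hinv : ∀ x ∈ Sᗮ, K x ∈ Sᗮ := by
    intro x hx
    rw [hmem] at hx ⊢
    constructor
    · intro i
      have := hK (e i) x
      rw [hef, inner_smul_left, hx.2 i] at this
      simpa using this.symm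
    · intro i
      have := hK (f i) x
      rw [hfe, inner_smul_left, hx.1 i] at this
      simpa using this.symm
  -- `-K²` is symmetric and preserves the complement of the family, so it has a unit eigenvector `u`
  -- there. The plane of `u` and `K u` is then `K`-invariant, with eigenvalue `‖K u‖²`.
  set L : E →ₗ[ℝ] E := -(K ∘ₗ K) with hL
  have hLsymm : L.IsSymmetric := by
    intro x y
    simp [hL, hK]
  have hLinv : ∀ x ∈ Sᗮ, L x ∈ Sᗮ := fun x hx => by
    simpa [hL] using hinv _ (hinv _ hx)
  have hnt : 0 < finrank ℝ Sᗮ := by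
    have := Submodule.finrank_add_finrank_orthogonal S
    omega
  have : Nontrivial Sᗮ := finrank_pos_iff.1 hnt
  have hr := hLsymm.restrict_invariant hLinv
  obtain ⟨μ, hμ⟩ : ∃ μ : ℝ, Module.End.HasEigenvalue (L.restrict hLinv) μ :=
    ⟨_, hr.hasEigenvalue_iSup_of_finiteDimensional⟩
  obtain ⟨w, hw⟩ := hμ.exists_hasEigenvector
  have hw0 : (w : E) ≠ 0 := by
    simpa using hw.2
  have hLw : L w = μ • (w : E) := by
    have := congrArg Subtype.val hw.apply_eq_smul
    simpa using this
  obtain ⟨u, hu1, huS, hLu⟩ : ∃ u : E, ‖u‖ = 1 ∧ u ∈ Sᗮ ∧ L u = μ • u := by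
    refine ⟨‖(w : E)‖⁻¹ • (w : E), ?_, Sᗮ.smul_mem _ w.2, ?_⟩
    · rw [norm_smul, norm_inv, norm_norm, inv_mul_cancel₀ (norm_ne_zero_iff.2 hw0)]
    · rw [map_smul, hLw, smul_comm]
  have hu0 : u ≠ 0 := by
    rintro rfl
    simp at hu1
  have hKu : K u ≠ 0 := fun h => hu0 (hinj (by simpa using h))
  have hs : 0 < ‖K u‖ := norm_pos_iff.2 hKu
  have hμs : μ = ‖K u‖ ^ 2 := by
    have h1 : inner ℝ u (L u) = μ := by
      rw [hLu, inner_smul_right, real_inner_self_eq_norm_sq, hu1]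
      simp
    rw [← h1, ← real_inner_self_eq_norm_sq, hK]
    simp [hL]
  have hKK : K (K u) = -(‖K u‖ ^ 2) • u := by
    rw [← hμs, neg_smul, ← hLu]
    simp [hL]
  have hvS : ‖K u‖⁻¹ • K u ∈ Sᗮ := Sᗮ.smul_mem _ (hinv _ huS)
  refine ⟨u, ‖K u‖⁻¹ • K u, ‖K u‖, hs, ?_, ?_, hu1, ?_, ?_, ((hmem _).1 huS).1, ((hmem _).1 huS).2,
    ((hmem _).1 hvS).1, ((hmem _).1 hvS).2⟩
  · rw [smul_smul, mul_inv_cancel₀ hs.ne', one_smul]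
  · rw [map_smul, hKK, smul_smul]
    congr 1
    field_simp
  · rw [norm_smul, norm_inv, norm_norm, inv_mul_cancel₀ hs.ne']
  · have h := hK u u
    rw [real_inner_comm] at h
    have : inner ℝ u (K u) = 0 := by linarith
    rw [inner_smul_right, this, mul_zero]

open Module in
-- Induction on `m`, adjoining one invariant plane at a time. In dimension `2n`, the choice `m = n`
-- gives an orthonormal basis.
theorem exists_rotation_family {E : Type*} [NormedAddCommGroup E] [InnerProductSpace ℝ E]
    [FiniteDimensional ℝ E] (K : E →ₗ[ℝ] E) (hK : ∀ x y, inner ℝ (K x) y = -inner ℝ x (K y))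
    (hinj : Function.Injective K) (m : ℕ) (hm : 2 * m ≤ finrank ℝ E) :
    ∃ (e f : Fin m → E) (c : Fin m → ℝ), (∀ i, 0 < c i) ∧ (∀ i, K (e i) = c i • f i) ∧
      (∀ i, K (f i) = -(c i) • e i) ∧ (∀ i j, inner ℝ (e i) (e j) = if i = j then (1 : ℝ) else 0) ∧
      (∀ i j, inner ℝ (f i) (f j) = if i = j then (1 : ℝ) else 0) ∧
      (∀ i j, inner ℝ (e i) (f j) = (0 : ℝ)) := by
  induction m with
  | zero => exact ⟨Fin.elim0, Fin.elim0, Fin.elim0, by simp, by simp, by simp, by simp, by simp,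
      by simp⟩
  | succ m ih =>
    obtain ⟨e, f, c, hc, hef, hfe, hee, hff, hfe0⟩ := ih (by omega)
    obtain ⟨u, v, s, hs, hu, hv, hu1, hv1, huv, heu, hfu, hev, hfv⟩ :=
      exists_extend_rotation_family K hK hinj e f c hef hfe (by simp; omega)
    have huu : inner ℝ u u = (1 : ℝ) := by rw [real_inner_self_eq_norm_sq, hu1]; norm_num
    have hvv : inner ℝ v v = (1 : ℝ) := by rw [real_inner_self_eq_norm_sq, hv1]; norm_num
    have heu' : ∀ i, inner ℝ u (e i) = (0 : ℝ) := fun i => by rw [real_inner_comm, heu]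
    have hfu' : ∀ i, inner ℝ u (f i) = (0 : ℝ) := fun i => by rw [real_inner_comm, hfu]
    have hfv' : ∀ i, inner ℝ v (f i) = (0 : ℝ) := fun i => by rw [real_inner_comm, hfv]
    refine ⟨Fin.cons u e, Fin.cons v f, Fin.cons s c, ?_, ?_, ?_, ?_, ?_, ?_⟩
    · exact Fin.cases (by simpa) (by simpa)
    · exact Fin.cases (by simpa) (by simpa)
    · exact Fin.cases (by simpa using hv) (by simpa using hfe)
    · refine Fin.cases (Fin.cases (by simp [*]) fun j => ?_) fun i => Fin.cases ?_ fun j => ?_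
      · simpa [(Fin.succ_ne_zero j).symm] using heu' j
      · simpa [Fin.succ_ne_zero i] using heu i
      · simpa using hee i j
    · refine Fin.cases (Fin.cases (by simp [*]) fun j => ?_) fun i => Fin.cases ?_ fun j => ?_
      · simpa [(Fin.succ_ne_zero j).symm] using hfv' j
      · simpa [Fin.succ_ne_zero i] using hfv i
      · simpa using hff i j
    · refine Fin.cases (Fin.cases (by simpa) fun j => ?_) fun i => Fin.cases ?_ fun j => ?_
      · simpa using hfu' j
      · simpa using hev i
      · simpa using hfe0 i j

namespace Matrix

/-- An invertible real skew-symmetric matrix of even size is orthogonally similar to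
`J diag (c, c)`, where the entries of `c` are positive and decreasing. -/
theorem exists_orthogonal_skew_normal_form {n : ℕ} (K : Matrix (Fin n ⊕ Fin n) (Fin n ⊕ Fin n) ℝ)
    (hK : Kᵀ = -K) (hu : IsUnit K) :
    ∃ (T : Matrix (Fin n ⊕ Fin n) (Fin n ⊕ Fin n) ℝ) (c : Fin n → ℝ), Tᵀ * T = 1 ∧
      Antitone c ∧ (∀ i, 0 < c i) ∧ K * T = T * (J (Fin n) ℝ * diagonal (Sum.elim c c)) := by
  obtain ⟨e, f, c, hc, hef, hfe, hee, hff, hfe0⟩ :=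
    exists_rotation_family (toEuclideanLin K)
      (fun x y => by
        simp only [toLpLin_apply, EuclideanSpace.inner_eq_star_dotProduct, star_trivial]
        rw [dotProduct_mulVec, ← mulVec_transpose, hK, neg_mulVec]
        simp [dotProduct_comm])
      (fun x y h => by
        have := mulVec_injective_of_isUnit hu (by simpa [toLpLin_apply] using h)
        exact WithLp.ofLp_injective _ this) n (by simp; omega)
  -- Sorting `-c` makes `c ∘ σ` decreasing, so that the reciprocals, which become the symplectic
  -- eigenvalues, increase.
  set σ : Equiv.Perm (Fin n) := Tuple.sort (fun i => -c i)
  have hσ := Tuple.monotone_sort (fun i => -c i)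
  refine ⟨of fun i j => Sum.elim (fun j => e (σ j) i) (fun j => f (σ j) i) j, c ∘ σ, ?_, ?_,
    fun i => hc _, ?_⟩
  · ext i j
    have key : ∀ x y : EuclideanSpace ℝ (Fin n ⊕ Fin n), ∑ a, x a * y a = inner ℝ x y := by
      intro x y
      simp only [EuclideanSpace.inner_eq_star_dotProduct, star_trivial, dotProduct]
      exact Finset.sum_congr rfl fun _ _ => mul_comm _ _
    have hfe0' : ∀ i j, inner ℝ (f i) (e j) = (0 : ℝ) := fun i j => by
      rw [real_inner_comm, hfe0]
    rcases i with i | i <;> rcases j with j | j <;>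
    simp [mul_apply, -Fintype.sum_sum_type, key, hee, hff, hfe0, hfe0', one_apply]
  · intro i j hij
    exact neg_le_neg_iff.1 (hσ hij)
  · have hef' : ∀ j i, (K *ᵥ (e j)) i = c j * f j i := fun j i =>
      congrArg (fun x : EuclideanSpace ℝ (Fin n ⊕ Fin n) => x i) (hef j)
    have hfe' : ∀ j i, (K *ᵥ (f j)) i = -c j * e j i := fun j i =>
      congrArg (fun x : EuclideanSpace ℝ (Fin n ⊕ Fin n) => x i) (hfe j)
    have hJ : J (Fin n) ℝ * diagonal (Sum.elim (c ∘ σ) (c ∘ σ)) =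
        fromBlocks 0 (-diagonal (c ∘ σ)) (diagonal (c ∘ σ)) 0 := by
      rw [J, ← fromBlocks_diagonal, fromBlocks_multiply]
      simp
    rw [hJ]
    ext i j
    rcases j with j | j
    · rw [mul_apply, mul_apply]
      refine (hef' (σ j) i).trans ?_
      simp [diagonal_apply, mul_comm]
    · rw [mul_apply, mul_apply]
      refine (hfe' (σ j) i).trans ?_
      simp [diagonal_apply, mul_comm]

end Matrix

/-! ### Real powers of positive definite matrices -/

namespace Matrix

/-- One pair `U`, `a` serves every exponent, which reduces the laws of powers to scalar ones. -/
theorem PosDef.exists_matrixRpow_eq {ι : Type*} [Fintype ι] [DecidableEq ι] {A : Matrix ι ι ℝ}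
    (hA : A.PosDef) : ∃ (U : Matrix ι ι ℝ) (a : ι → ℝ), Uᵀ * U = 1 ∧ U * Uᵀ = 1 ∧ (∀ i, 0 < a i) ∧
      ∀ t, matrixRpow A t = U * diagonal (fun i => a i ^ t) * Uᵀ := by
  refine ⟨hA.isHermitian.eigenvectorUnitary, hA.isHermitian.eigenvalues, ?_, ?_,
    hA.eigenvalues_pos, fun t => ?_⟩
  · simpa [star_eq_conjTranspose] using
      Unitary.coe_star_mul_self hA.isHermitian.eigenvectorUnitary
  · simpa [star_eq_conjTranspose] using
      Unitary.coe_mul_star_self hA.isHermitian.eigenvectorUnitary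
  · rw [matrixRpow, hA.isHermitian.cfc_eq, IsHermitian.cfc, Unitary.conjStarAlgAut_apply,
      star_eq_conjTranspose, conjTranspose_eq_transpose_of_trivial]
    rfl

section matrixRpow

variable {ι : Type*} [Fintype ι] [DecidableEq ι] {A : Matrix ι ι ℝ}

theorem PosDef.matrixRpow_add (hA : A.PosDef) (s t : ℝ) :
    matrixRpow A s * matrixRpow A t = matrixRpow A (s + t) := by
  obtain ⟨U, a, hU, -, ha, h⟩ := hA.exists_matrixRpow_eq
  have : diagonal (fun i => a i ^ (s + t)) =
      diagonal (fun i => a i ^ s) * diagonal (fun i => a i ^ t) := by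
    rw [diagonal_mul_diagonal]
    simp only [Real.rpow_add (ha _)]
  rw [h, h, h, this]
  calc _ = U * diagonal (fun i => a i ^ s) * (Uᵀ * U) * diagonal (fun i => a i ^ t) * Uᵀ := by
        simp only [Matrix.mul_assoc]
    _ = _ := by
        rw [hU, Matrix.mul_one]
        simp only [Matrix.mul_assoc]

theorem PosDef.matrixRpow_one (hA : A.PosDef) : matrixRpow A 1 = A := by
  have : IsSelfAdjoint A := hA.isHermitian
  simp only [matrixRpow, Real.rpow_one]
  exact cfc_id' ℝ A

theorem PosDef.matrixRpow_zero (hA : A.PosDef) : matrixRpow A 0 = 1 := by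
  obtain ⟨U, a, -, hU, ha, h⟩ := hA.exists_matrixRpow_eq
  simp [h, hU]

theorem PosDef.transpose_matrixRpow (hA : A.PosDef) (t : ℝ) :
    (matrixRpow A t)ᵀ = matrixRpow A t := by
  obtain ⟨U, a, -, -, -, h⟩ := hA.exists_matrixRpow_eq
  simp [h, Matrix.mul_assoc]

theorem PosDef.isUnit_matrixRpow (hA : A.PosDef) (t : ℝ) : IsUnit (matrixRpow A t) :=
  IsUnit.of_mul_eq_one (matrixRpow A (-t)) (by
    rw [hA.matrixRpow_add, add_neg_cancel, hA.matrixRpow_zero])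

theorem PosDef.posDef_matrixRpow (hA : A.PosDef) (t : ℝ) : (matrixRpow A t).PosDef := by
  have h := hA.matrixRpow_add (t / 2) (t / 2)
  rw [add_halves] at h
  rw [← h]
  nth_rewrite 1 [← hA.transpose_matrixRpow (t / 2)]
  rw [← conjTranspose_eq_transpose_of_trivial]
  exact PosDef.conjTranspose_mul_self _ (mulVec_injective_of_isUnit (hA.isUnit_matrixRpow _))

theorem PosDef.det_matrixRpow (hA : A.PosDef) (t : ℝ) : (matrixRpow A t).det = A.det ^ t := by
  obtain ⟨U, a, hU, -, ha, h⟩ := hA.exists_matrixRpow_eq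
  have hdet : ∀ s, (matrixRpow A s).det = ∏ i, a i ^ s := fun s => by
    have h1 : U.det * Uᵀ.det = 1 := by rw [mul_comm, ← det_mul, hU, det_one]
    rw [h, det_mul, det_mul, det_diagonal, mul_right_comm, h1, one_mul]
  have h1 := hdet 1
  rw [hA.matrixRpow_one] at h1
  simp only [Real.rpow_one] at h1
  rw [hdet, h1, Real.finsetProd_rpow _ _ fun i _ => (ha i).le]

theorem PosDef.matrixRpow_matrixRpow (hA : A.PosDef) (s t : ℝ) :
    matrixRpow (matrixRpow A s) t = matrixRpow A (s * t) := by
  have hsa : IsSelfAdjoint A := hA.isHermitian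
  -- Every function is continuous on a finite spectrum, so the composition rule of the functional
  -- calculus applies for all real exponents.
  have hfin : (spectrum ℝ A).Finite := Matrix.finite_real_spectrum
  rw [matrixRpow, matrixRpow, ← cfc_comp' (fun x : ℝ => x ^ t) (fun x : ℝ => x ^ s) A
    ((hfin.image _).continuousOn _) (hfin.continuousOn _), matrixRpow]
  refine cfc_congr fun x hx => ?_
  rw [hA.isHermitian.spectrum_real_eq_range_eigenvalues] at hx
  obtain ⟨i, rfl⟩ := hx
  exact (Real.rpow_mul (hA.eigenvalues_pos i).le _ _).symm

end matrixRpow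

theorem J_mul_diagonal_comm {l R : Type*} [Fintype l] [DecidableEq l] [CommRing R] (c : l → R) :
    J l R * diagonal (Sum.elim c c) = diagonal (Sum.elim c c) * J l R := by
  rw [J, ← fromBlocks_diagonal, fromBlocks_multiply, fromBlocks_multiply]
  simp

end Matrix

/-! ### Williamson's theorem and the singular values of `S J S` -/

open Matrix

/-- Williamson's theorem: positive definite matrices have symplectic eigenvalues. -/
theorem exists_isSymplecticEigenvalues {n : ℕ} {A : Matrix (Fin n ⊕ Fin n) (Fin n ⊕ Fin n) ℝ}
    (hA : A.PosDef) : ∃ d, IsSymplecticEigenvalues A d := by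
  -- With `Q = A^(-1/2)`, the matrix `Q J Q` is skew and `T` brings it to `J diag(c, c)`. Scaling by
  -- `R = diag(c, c)^(-1/2)` makes `M = Q T R` symplectic, and `Mᵀ A M = R²` identifies `d = 1/c`.
  set Q := matrixRpow A (-(1 / 2)) with hQ
  have hQt : Qᵀ = Q := hA.transpose_matrixRpow _
  have hQu : IsUnit Q := hA.isUnit_matrixRpow _
  have hQA : Q * A * Q = 1 := by
    have h := hA.matrixRpow_add (-(1 / 2)) 1
    rw [hA.matrixRpow_one] at h
    rw [hQ, h, hA.matrixRpow_add, ← hA.matrixRpow_zero]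
    norm_num
  obtain ⟨T, c, hT, hcm, hc, hKT⟩ := exists_orthogonal_skew_normal_form (Q * J (Fin n) ℝ * Q)
    (by simp [hQt, Matrix.mul_assoc])
    ((hQu.mul ((isUnit_iff_isUnit_det _).2 (isUnit_det_J _ _))).mul hQu)
  set r : Fin n → ℝ := fun i => √(c i)⁻¹ with hr
  have hrr : ∀ i, r i * r i = (c i)⁻¹ := fun i => Real.mul_self_sqrt (inv_pos.2 (hc i)).le
  set R := diagonal (Sum.elim r r) with hR
  have hRR : R * R = diagonal (Sum.elim (fun i => (c i)⁻¹) (fun i => (c i)⁻¹)) := by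
    rw [hR, diagonal_mul_diagonal]
    congr 1
    ext i
    rcases i with i | i <;> simp [hrr]
  have hRt : Rᵀ = R := diagonal_transpose _
  have hcR : diagonal (Sum.elim c c) * (R * R) = 1 := by
    rw [hRR, diagonal_mul_diagonal, ← diagonal_one]
    congr 1
    ext i
    rcases i with i | i <;> simp [(hc i).ne']
  have hRc : R * diagonal (Sum.elim c c) = diagonal (Sum.elim c c) * R :=
    (commute_diagonal _ _).eq
  refine ⟨fun i => (c i)⁻¹, fun i j hij => inv_anti₀ (hc j) (hcm hij), fun j => inv_pos.2 (hc j),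
    Q * T * R, ?_, ?_⟩
  · rw [SymplecticGroup.mem_iff']
    calc (Q * T * R)ᵀ * J (Fin n) ℝ * (Q * T * R)
        = R * Tᵀ * (Q * J (Fin n) ℝ * Q * T) * R := by
          simp only [transpose_mul, hQt, hRt, Matrix.mul_assoc]
      _ = R * (Tᵀ * T) * (J (Fin n) ℝ * diagonal (Sum.elim c c)) * R := by
          rw [hKT]
          simp only [Matrix.mul_assoc]
      _ = J (Fin n) ℝ * (diagonal (Sum.elim c c) * (R * R)) := by
          rw [hT, Matrix.mul_one, ← Matrix.mul_assoc R, ← J_mul_diagonal_comm, Matrix.mul_assoc _ R,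
            hRc]
          simp only [Matrix.mul_assoc]
      _ = J (Fin n) ℝ := by rw [hcR, Matrix.mul_one]
  · rw [fromBlocks_diagonal, ← hRR]
    calc (Q * T * R)ᵀ * A * (Q * T * R) = R * (Tᵀ * (Q * A * Q) * T) * R := by
          simp only [transpose_mul, hQt, hRt, Matrix.mul_assoc]
      _ = R * R := by rw [hQA, Matrix.mul_one, hT, Matrix.mul_one]

theorem isSymplecticEigenvalues_symplecticEigenvalues {n : ℕ}
    {A : Matrix (Fin n ⊕ Fin n) (Fin n ⊕ Fin n) ℝ} (hA : A.PosDef) :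
    IsSymplecticEigenvalues A (symplecticEigenvalues A) := by
  have h := exists_isSymplecticEigenvalues hA
  rw [symplecticEigenvalues, dif_pos h]
  exact h.choose_spec

theorem IsSymplecticEigenvalues.det_eq {n : ℕ} {A : Matrix (Fin n ⊕ Fin n) (Fin n ⊕ Fin n) ℝ}
    {d : Fin n → ℝ} (h : IsSymplecticEigenvalues A d) : A.det = ∏ i, Sum.elim d d i := by
  obtain ⟨-, -, M, hM, hMA⟩ := h
  have := congrArg det hMA
  rwa [fromBlocks_diagonal, det_diagonal, det_mul, det_mul, det_transpose,
    SymplecticGroup.det_eq_one hM, one_mul, mul_one] at this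

/-- A symmetric square root `S` of `A` takes `J` to `S J S`, whose singular values are the
symplectic eigenvalues of `A`, each counted twice. -/
theorem IsSymplecticEigenvalues.exists_orthogonal {n : ℕ}
    {A S : Matrix (Fin n ⊕ Fin n) (Fin n ⊕ Fin n) ℝ} {d : Fin n → ℝ}
    (h : IsSymplecticEigenvalues A d) (hS : Sᵀ = S) (hSA : S * S = A) :
    ∃ T : Matrix (Fin n ⊕ Fin n) (Fin n ⊕ Fin n) ℝ, Tᵀ * T = 1 ∧
      S * J (Fin n) ℝ * S = T * diagonal (Sum.elim d d) * J (Fin n) ℝ * Tᵀ := by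
  obtain ⟨-, hd, M, hM, hMA⟩ := h
  rw [fromBlocks_diagonal] at hMA
  -- The witness is `T = S M D^(-1/2)`. Its orthogonality is `Mᵀ A M = D`, and the second identity
  -- reduces to `M J Mᵀ = J`, because `J` commutes with `diag(r, r)`.
  set r : Fin n → ℝ := fun i => (√(d i))⁻¹ with hr
  have hrr : ∀ i, r i * d i * r i = 1 := fun i => by
    have h1 := Real.mul_self_sqrt (hd i).le
    have h2 := (Real.sqrt_pos.2 (hd i)).ne'
    simp only [hr]
    field_simp
    nlinarith
  set R := diagonal (Sum.elim r r) with hR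
  set D := diagonal (Sum.elim d d) with hD
  have hRDR : R * D * R = 1 := by
    rw [hR, hD, diagonal_mul_diagonal, diagonal_mul_diagonal, ← diagonal_one]
    congr 1
    ext i
    rcases i with i | i <;> simp [hrr]
  have hRt : Rᵀ = R := diagonal_transpose _
  have hJR : J (Fin n) ℝ * R = R * J (Fin n) ℝ := J_mul_diagonal_comm r
  refine ⟨S * M * R, ?_, ?_⟩
  · calc (S * M * R)ᵀ * (S * M * R) = R * (Mᵀ * (S * S) * M) * R := by
          simp only [transpose_mul, hS, hRt, Matrix.mul_assoc]
      _ = 1 := by rw [hSA, hMA, hRDR]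
  · symm
    calc S * M * R * D * J (Fin n) ℝ * (S * M * R)ᵀ
        = S * M * (R * D * (J (Fin n) ℝ * R)) * Mᵀ * S := by
          simp only [transpose_mul, hS, hRt, Matrix.mul_assoc]
      _ = S * (M * ((R * D * R) * J (Fin n) ℝ) * Mᵀ) * S := by
          rw [hJR]
          simp only [Matrix.mul_assoc]
      _ = S * J (Fin n) ℝ * S := by
          rw [hRDR, Matrix.one_mul, SymplecticGroup.mem_iff.1 hM]

/-! ### Complex powers and the three lines theorem -/

namespace Matrix

section complexPower

variable {N : Type*} [Fintype N] [DecidableEq N]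

/-- The complex power `X ^ z` of the positive matrix `X = U diag(a) Uᴴ`. -/
noncomputable def complexPower (U : Matrix N N ℂ) (a : N → ℝ) (z : ℂ) : Matrix N N ℂ :=
  U * diagonal (fun i => Complex.exp (z * Real.log (a i))) * Uᴴ

variable {U : Matrix N N ℂ} {a : N → ℝ}

theorem complexPower_mul (hU : Uᴴ * U = 1) (z w : ℂ) :
    complexPower U a z * complexPower U a w = complexPower U a (z + w) := by
  have : diagonal (fun i => Complex.exp ((z + w) * Real.log (a i))) =
      diagonal (fun i => Complex.exp (z * Real.log (a i))) *
        diagonal (fun i => Complex.exp (w * Real.log (a i))) := by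
    rw [diagonal_mul_diagonal]
    simp only [add_mul, Complex.exp_add]
  rw [complexPower, complexPower, complexPower, this]
  calc _ = U * diagonal (fun i => Complex.exp (z * Real.log (a i))) * (Uᴴ * U) *
        diagonal (fun i => Complex.exp (w * Real.log (a i))) * Uᴴ := by
        simp only [Matrix.mul_assoc]
    _ = _ := by
        rw [hU, Matrix.mul_one]
        simp only [Matrix.mul_assoc]

theorem conjTranspose_complexPower (z : ℂ) :
    (complexPower U a z)ᴴ = complexPower U a (star z) := by
  rw [complexPower, complexPower, conjTranspose_mul, conjTranspose_mul, conjTranspose_conjTranspose,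
    diagonal_conjTranspose, Matrix.mul_assoc]
  congr 3
  ext i
  simp [← Complex.exp_conj]

theorem complexPower_zero (hU : U * Uᴴ = 1) : complexPower U a 0 = 1 := by
  simp [complexPower, hU]

/-- On the imaginary axis `star z = -z`, so the adjoint is the inverse. This removes the imaginary
part of the exponent from the bounds on both boundary lines. -/
theorem conjTranspose_complexPower_mul_self (hU : Uᴴ * U = 1) (hU' : U * Uᴴ = 1) {z : ℂ}
    (hz : z.re = 0) : (complexPower U a z)ᴴ * complexPower U a z = 1 := by
  have : star z + z = 0 := by
    apply Complex.ext <;> simp [hz]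
  rw [conjTranspose_complexPower, complexPower_mul hU, this, complexPower_zero hU']

theorem differentiable_det {E k : Type*} [NormedAddCommGroup E] [NormedSpace ℂ E] [Fintype k]
    [DecidableEq k] {G : E → Matrix k k ℂ} (hG : ∀ i j, Differentiable ℂ fun v => G v i j) :
    Differentiable ℂ fun v => (G v).det := by
  simp only [det_apply']
  fun_prop

/-- The three lines theorem for the minors of `X ^ (z / 2) L X ^ (z / 2)`. -/
theorem norm_det_complexPower_le {k : Type*} [Fintype k] [DecidableEq k] (L : Matrix N N ℂ)
    (W : Matrix k N ℂ) (V : Matrix N k ℂ) {b C : ℝ}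
    (h0 : ∀ z : ℂ, z.re = 0 →
      ‖(W * (complexPower U a (z / 2) * L * complexPower U a (z / 2)) * V).det‖ ≤ b)
    (h1 : ∀ z : ℂ, z.re = 1 →
      ‖(W * (complexPower U a (z / 2) * L * complexPower U a (z / 2)) * V).det‖ ≤ C)
    {t : ℝ} (ht0 : 0 ≤ t) (ht1 : t ≤ 1) :
    ‖(W * (complexPower U a (t / 2) * L * complexPower U a (t / 2)) * V).det‖ ≤
      b ^ (1 - t) * C ^ t := by
  -- The determinant factors through the diagonal entries `v z`. `G` is entire on `N → ℂ`, and `v`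
  -- maps the closed strip into a compact ball, whence the boundedness needed for the three lines
  -- theorem.
  set G : (N → ℂ) → ℂ := fun v =>
    (W * ((U * diagonal v * Uᴴ) * L * (U * diagonal v * Uᴴ)) * V).det with hG
  set v : ℂ → N → ℂ := fun z i => Complex.exp (z / 2 * Real.log (a i)) with hv
  have hGd : Differentiable ℂ G := by
    refine differentiable_det fun i j => ?_
    simp only [mul_apply, diagonal_apply, mul_ite, mul_zero, Finset.sum_ite_eq',
      Finset.mem_univ, if_true]
    fun_prop
  have hvd : Differentiable ℂ v := by
    rw [differentiable_pi]
    intro i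
    fun_prop
  have hB : BddAbove ((norm ∘ (G ∘ v)) '' Complex.HadamardThreeLines.verticalClosedStrip 0 1) := by
    set r : ℝ := Real.exp (∑ i, |Real.log (a i)|)
    have hc := (isCompact_closedBall (0 : N → ℂ) r).bddAbove_image
      (f := fun x => ‖G x‖) hGd.continuous.norm.continuousOn
    refine hc.mono ?_
    rintro _ ⟨z, hz, rfl⟩
    refine ⟨v z, ?_, rfl⟩
    rw [mem_closedBall_zero_iff, pi_norm_le_iff_of_nonneg (Real.exp_pos _).le]
    intro i
    have hre : (z / 2 * Real.log (a i)).re = z.re / 2 * Real.log (a i) := by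
      rw [Complex.re_mul_ofReal]
      simp
    simp only [hv]
    rw [Complex.norm_exp, hre, Real.exp_le_exp]
    obtain ⟨hz0, hz1⟩ : 0 ≤ z.re ∧ z.re ≤ 1 := hz
    calc z.re / 2 * Real.log (a i) ≤ |z.re / 2 * Real.log (a i)| := le_abs_self _
      _ = z.re / 2 * |Real.log (a i)| := by rw [abs_mul, abs_of_nonneg (by linarith)]
      _ ≤ 1 * |Real.log (a i)| := by gcongr; linarith
      _ ≤ ∑ i, |Real.log (a i)| := by
        rw [one_mul]
        exact Finset.single_le_sum (f := fun i => |Real.log (a i)|) (fun i _ => abs_nonneg _)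
          (Finset.mem_univ i)
  have := Complex.HadamardThreeLines.norm_le_interp_of_mem_verticalClosedStrip₀₁' (G ∘ v)
    (z := t) (a := b) (b := C) ⟨by simpa using ht0, by simpa using ht1⟩
    (hGd.comp hvd).diffContOnCl hB h0 h1
  rw [Complex.ofReal_re] at this
  exact this

end complexPower

section complexify

variable {m n p : Type*} [Fintype n]

theorem map_ofReal_mul (X : Matrix m n ℝ) (Y : Matrix n p ℝ) :
    (X * Y).map Complex.ofReal = X.map Complex.ofReal * Y.map Complex.ofReal :=
  Matrix.map_mul (f := Complex.ofRealHom)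

theorem conjTranspose_map_ofReal (X : Matrix m p ℝ) :
    (X.map Complex.ofReal)ᴴ = Xᵀ.map Complex.ofReal := by
  ext i j
  simp

theorem conjTranspose_map_ofReal_mul_self [DecidableEq n] {X : Matrix n n ℝ} (hX : Xᵀ * X = 1) :
    (X.map Complex.ofReal)ᴴ * X.map Complex.ofReal = 1 := by
  rw [conjTranspose_map_ofReal, ← map_ofReal_mul, hX]
  exact Matrix.map_one _ Complex.ofReal_zero Complex.ofReal_one

end complexify

theorem PosDef.exists_complexPower {ι : Type*} [Fintype ι] [DecidableEq ι] {A : Matrix ι ι ℝ}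
    (hA : A.PosDef) : ∃ (U : Matrix ι ι ℂ) (a : ι → ℝ), Uᴴ * U = 1 ∧ U * Uᴴ = 1 ∧
      ∀ t : ℝ, complexPower U a t = (matrixRpow A t).map Complex.ofReal := by
  obtain ⟨U, a, hU, -, ha, h⟩ := hA.exists_matrixRpow_eq
  refine ⟨U.map Complex.ofReal, a, conjTranspose_map_ofReal_mul_self hU, ?_, fun t => ?_⟩
  · exact mul_eq_one_comm.1 (conjTranspose_map_ofReal_mul_self hU)
  · rw [complexPower, h, map_ofReal_mul, map_ofReal_mul, conjTranspose_map_ofReal,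
      diagonal_map Complex.ofReal_zero]
    congr 3
    ext i
    rw [Real.rpow_def_of_pos (ha i), Complex.ofReal_exp, mul_comm,
      Complex.ofReal_mul]

end Matrix

/-! ### Interpolation between exponents `0` and `1` -/

/-- Products of distinct entries of `(d, d)`, `d` the symplectic eigenvalues of `A ^ t`, are at most
the `t`-th power of the largest such product for `A`. -/
theorem IsSymplecticEigenvalues.prod_le_rpow {n : ℕ} {A : Matrix (Fin n ⊕ Fin n) (Fin n ⊕ Fin n) ℝ}
    (hA : A.PosDef) {t : ℝ} (ht0 : 0 ≤ t) (ht1 : t ≤ 1) {d e : Fin n → ℝ}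
    (hd : IsSymplecticEigenvalues A d) (he : IsSymplecticEigenvalues (matrixRpow A t) e)
    {k : Type*} [Fintype k] {C : ℝ} (hC0 : 0 ≤ C)
    (hC : ∀ f : k → Fin n ⊕ Fin n, Function.Injective f → ∏ i, Sum.elim d d (f i) ≤ C)
    {g : k → Fin n ⊕ Fin n} (hg : Function.Injective g) :
    ∏ i, Sum.elim e e (g i) ≤ C ^ t := by
  classical
  obtain ⟨U, a, hU, hU', hUa⟩ := hA.exists_complexPower
  set P := complexPower U a
  set Jc : Matrix (Fin n ⊕ Fin n) (Fin n ⊕ Fin n) ℂ := J (Fin n) ℂ with hJc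
  have hJmap : (J (Fin n) ℝ).map Complex.ofReal = Jc := map_J (Fin n) Complex.ofRealHom
  have hJJ : Jcᴴ * Jc = 1 := by
    rw [← hJmap]
    refine conjTranspose_map_ofReal_mul_self ?_
    rw [J_transpose, Matrix.neg_mul, J_squared, neg_neg]
  have hpos : ∀ {x : Fin n → ℝ}, (∀ i, 0 < x i) → ∀ i, 0 ≤ Sum.elim x x i := fun h i => by
    rcases i with i | i <;> exact (h _).le
  have factor : ∀ {s : ℝ} {x : Fin n → ℝ}, IsSymplecticEigenvalues (matrixRpow A s) x →
      ∃ T : Matrix (Fin n ⊕ Fin n) (Fin n ⊕ Fin n) ℂ, Tᴴ * T = 1 ∧ T * Tᴴ = 1 ∧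
        P (s / 2) * Jc * P (s / 2) =
          T * diagonal (fun i => ((Sum.elim x x i : ℝ) : ℂ)) * Jc * Tᴴ := by
    intro s x hx
    obtain ⟨T, hT, hTS⟩ := hx.exists_orthogonal (S := matrixRpow A (s / 2))
      (hA.transpose_matrixRpow _) (by rw [hA.matrixRpow_add, add_halves])
    have hTc := conjTranspose_map_ofReal_mul_self hT
    refine ⟨T.map Complex.ofReal, hTc, mul_eq_one_comm.1 hTc, ?_⟩
    have h2 : P (s / 2) = (matrixRpow A (s / 2)).map Complex.ofReal := by
      rw [← hUa]
      push_cast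
      rfl
    have h3 := congrArg (fun X : Matrix _ _ ℝ => X.map Complex.ofReal) hTS
    simp only [map_ofReal_mul, hJmap, diagonal_map Complex.ofReal_zero] at h3
    rw [h2, h3, conjTranspose_map_ofReal]
  have iso : ∀ {X : Matrix (Fin n ⊕ Fin n) (Fin n ⊕ Fin n) ℂ} {V : Matrix (Fin n ⊕ Fin n) k ℂ},
      Xᴴ * X = 1 → Vᴴ * V = 1 → (X * V)ᴴ * (X * V) = 1 := by
    intro X V hX hV
    rw [conjTranspose_mul, Matrix.mul_assoc, ← Matrix.mul_assoc Xᴴ, hX, Matrix.one_mul, hV]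
  have unit : ∀ {z : ℂ}, z.re = 0 → (P z)ᴴ * P z = 1 ∧ ((P z)ᴴ)ᴴ * (P z)ᴴ = 1 := by
    intro z hz
    have h := conjTranspose_complexPower_mul_self (a := a) hU hU' hz
    exact ⟨h, by rw [conjTranspose_conjTranspose]; exact mul_eq_one_comm.1 h⟩
  obtain ⟨T, hT, -, hTe⟩ := factor he
  set E : Matrix (Fin n ⊕ Fin n) k ℂ := of fun i j => if i = g j then 1 else 0 with hE
  have hEE : Eᴴ * E = 1 := by
    ext i j
    simp [hE, mul_apply, -Fintype.sum_sum_type, one_apply, hg.eq_iff, eq_comm]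
  have hEdE : Eᴴ * diagonal (fun i => ((Sum.elim e e i : ℝ) : ℂ)) * E =
      diagonal (fun j => ((Sum.elim e e (g j) : ℝ) : ℂ)) := by
    ext i j
    by_cases hij : i = j
    · subst hij
      simp [hE, mul_apply, -Fintype.sum_sum_type, diagonal_apply]
    · have : g j ≠ g i := fun h => hij (hg h).symm
      simp [hE, mul_apply, -Fintype.sum_sum_type, diagonal_apply, hij, this]
  have hJJ' : (Jcᴴ)ᴴ * Jcᴴ = 1 := by
    rw [conjTranspose_conjTranspose]
    exact mul_eq_one_comm.1 hJJ
  -- The columns of `E` are the basis vectors indexed by `g`. Since `T` diagonalises for `A^t` and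
  -- `Jcᴴ` cancels the factor `Jc`, the determinant becomes exactly the product of the chosen
  -- entries.
  set W := T * E with hW
  set V := T * (Jcᴴ * E) with hV
  have hWW : Wᴴ * W = 1 := iso hT hEE
  have hVV : Vᴴ * V = 1 := iso hT (iso hJJ' hEE)
  have hval : ‖(Wᴴ * (P (t / 2) * Jc * P (t / 2)) * V).det‖ = ∏ i, Sum.elim e e (g i) := by
    have h1 : Wᴴ * (P (t / 2) * Jc * P (t / 2)) * V =
        Eᴴ * diagonal (fun i => ((Sum.elim e e i : ℝ) : ℂ)) * E := by
      rw [hTe, hW, hV, conjTranspose_mul]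
      calc _ = Eᴴ * (Tᴴ * T) * diagonal (fun i => ((Sum.elim e e i : ℝ) : ℂ)) *
            (Jc * (Tᴴ * T) * Jcᴴ) * E := by
            simp only [Matrix.mul_assoc]
        _ = _ := by
            rw [hT, Matrix.mul_one, Matrix.mul_one, mul_eq_one_comm.1 hJJ, Matrix.mul_one]
    rw [h1, hEdE, det_diagonal, norm_prod]
    exact Finset.prod_congr rfl fun i _ => by
      rw [Complex.norm_real, Real.norm_of_nonneg (hpos he.2.1 _)]
  -- The bound takes the three lines form `1^(1-t) * C^t`, with `1` on `Re z = 0` and `C` on `Re z =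
  -- 1`.
  rw [← hval, ← one_mul (C ^ t), ← Real.one_rpow (1 - t)]
  refine norm_det_complexPower_le Jc Wᴴ V (fun z hz => ?_) (fun z hz => ?_) ht0 ht1
  -- All factors are unitary here, so the minor bound applies with every `δ` equal to `1`.
  · have hz2 : (z / 2).re = 0 := by simp [hz]
    have h := norm_det_conjTranspose_mul_diagonal_mul_le (k := k) (N := Fin n ⊕ Fin n)
      (δ := fun _ => 1) (C := 1) (fun _ => zero_le_one) zero_le_one (by simp) (W := W)
      (V := P (z / 2) * (Jc * (P (z / 2) * V))) hWW
      (iso (unit hz2).1 (iso hJJ (iso (unit hz2).1 hVV)))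
    simpa [Matrix.mul_assoc] using h
  -- With `z / 2 = y + 1/2` and `y` imaginary, the unitary `P y` is split off on the outside of both
  -- powers and absorbed into `W` and `V`. What remains is `A^(1/2) J A^(1/2)`.
  · obtain ⟨y, hy, hzy⟩ : ∃ y : ℂ, y.re = 0 ∧ z / 2 = y + (1 : ℝ) / 2 :=
      ⟨z / 2 - (1 : ℝ) / 2, by simp [hz], by ring⟩
    obtain ⟨T₁, hT₁, hT₁', hTd⟩ := factor (s := 1) (by rwa [hA.matrixRpow_one])
    have h := norm_det_conjTranspose_mul_diagonal_mul_le (hpos hd.2.1) hC0 hC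
      (W := T₁ᴴ * ((P y)ᴴ * W)) (V := Jc * (T₁ᴴ * (P y * V)))
      (iso (by rwa [conjTranspose_conjTranspose]) (iso (unit hy).2 hWW))
      (iso hJJ (iso (by rwa [conjTranspose_conjTranspose]) (iso (unit hy).1 hVV)))
    refine le_of_eq_of_le (congrArg (fun X : Matrix k k ℂ => ‖X.det‖) ?_) h
    have e1 : P (z / 2) = P y * P ((1 : ℝ) / 2) := by
      rw [hzy]
      exact (complexPower_mul hU _ _).symm
    have e2 : P (z / 2) = P ((1 : ℝ) / 2) * P y := by
      rw [hzy, add_comm]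
      exact (complexPower_mul hU _ _).symm
    calc Wᴴ * (P (z / 2) * Jc * P (z / 2)) * V
        = Wᴴ * (P y * (P ((1 : ℝ) / 2) * Jc * P ((1 : ℝ) / 2)) * P y) * V := by
          nth_rewrite 1 [e1]
          rw [e2]
          simp only [Matrix.mul_assoc]
      _ = _ := by
          rw [hTd]
          simp only [conjTranspose_mul, conjTranspose_conjTranspose, Matrix.mul_assoc]

/-! ### Ordered products and log majorisation -/

theorem decreasingRearrangement_eq_self {m : ℕ} {x : Fin m → ℝ} (hx : Antitone x) :
    decreasingRearrangement x = x := by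
  have h : x ∘ Tuple.sort x = x ∘ Fin.revPerm :=
    Tuple.unique_monotone (Tuple.monotone_sort x) fun i j hij => hx (Fin.rev_le_rev.2 hij)
  ext j
  simpa [decreasingRearrangement] using congrFun h (Fin.rev j)

theorem prod_castLE_eq_prod_filter_lt {m k : ℕ} (hk : k ≤ m) (h : Fin m → ℝ) :
    ∏ i : Fin k, h (Fin.castLE hk i) = ∏ j : Fin m with j.val < k, h j := by
  refine Finset.prod_bij (fun i _ => Fin.castLE hk i) (by simp)
    (fun _ _ _ _ hij => Fin.castLE_injective hk hij) (fun j hj => ?_) fun _ _ => rfl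
  exact ⟨⟨j, (Finset.mem_filter.1 hj).2⟩, Finset.mem_univ _, rfl⟩

/-- The first `k` entries of a decreasing positive vector have the largest product among all
choices of `k` distinct entries. -/
theorem prod_comp_le_prod_filter_lt {m k : ℕ} (hk : k ≤ m) {h : Fin m → ℝ} (hh : Antitone h)
    (hpos : ∀ j, 0 < h j) {f : Fin k → Fin m} (hf : Function.Injective f) :
    ∏ i, h (f i) ≤ ∏ j : Fin m with j.val < k, h j := by
  classical
  set s : Finset (Fin m) := Finset.univ.image f
  have hs : s.card = k := by simp [s, Finset.card_image_of_injective _ hf]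
  -- The `i`-th smallest element of a set of indices is at least `i`, so listing the image in
  -- increasing order compares the products factor by factor.
  have hle : ∀ i : Fin k, Fin.castLE hk i ≤ s.orderEmbOfFin hs i := by
    rintro ⟨i, hi⟩
    induction i with
    | zero => exact Nat.zero_le _
    | succ i ih =>
      have h1 := ih (by omega)
      have h2 : s.orderEmbOfFin hs ⟨i, by omega⟩ < s.orderEmbOfFin hs ⟨i + 1, hi⟩ :=
        (s.orderEmbOfFin hs).strictMono (by simp)
      rw [Fin.le_def] at h1 ⊢
      rw [Fin.lt_def] at h2
      simp only [Fin.val_castLE] at h1 ⊢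
      omega
  have h1 : ∏ i, h (f i) = ∏ i, h (s.orderEmbOfFin hs i) := by
    rw [← Finset.prod_image (s := Finset.univ) (g := f) (f := h) fun a _ b _ hab => hf hab,
      ← Finset.prod_image (s := Finset.univ) (g := s.orderEmbOfFin hs) (f := h)
        fun a _ b _ hab => (s.orderEmbOfFin hs).injective hab,
      Finset.image_orderEmbOfFin_univ]
  rw [h1, ← prod_castLE_eq_prod_filter_lt hk]
  exact Finset.prod_le_prod (fun i _ => (hpos _).le) fun i _ => hh (hle i)

theorem antitone_symplecticEigenvaluesHat {n : ℕ} {A : Matrix (Fin n ⊕ Fin n) (Fin n ⊕ Fin n) ℝ}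
    (hA : A.PosDef) : Antitone (symplecticEigenvaluesHat A) := fun _ _ hij =>
  (isSymplecticEigenvalues_symplecticEigenvalues hA).1
    (Fin.rev_le_rev.2 (Nat.div_le_div_right hij))

theorem symplecticEigenvaluesHat_pos {n : ℕ} {A : Matrix (Fin n ⊕ Fin n) (Fin n ⊕ Fin n) ℝ}
    (hA : A.PosDef) (j : Fin (2 * n)) : 0 < symplecticEigenvaluesHat A j :=
  (isSymplecticEigenvalues_symplecticEigenvalues hA).2.1 _

/-- An enumeration of the `2n` doubled indices along which `(d, d)` becomes
`(dₙ, dₙ, …, d₁, d₁)`. -/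
theorem exists_equiv_symplecticEigenvaluesHat (n : ℕ) :
    ∃ φ : Fin (2 * n) ≃ Fin n ⊕ Fin n, ∀ (A : Matrix (Fin n ⊕ Fin n) (Fin n ⊕ Fin n) ℝ) j,
      symplecticEigenvaluesHat A j =
        Sum.elim (symplecticEigenvalues A) (symplecticEigenvalues A) (φ j) := by
  -- The parity of `j` selects the copy of `Fin n`, and `j / 2` the position counted from the
  -- largest eigenvalue.
  set φ : Fin (2 * n) → Fin n ⊕ Fin n := fun j =>
    if j.val % 2 = 0 then Sum.inl (Fin.rev ⟨j / 2, by omega⟩)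
    else Sum.inr (Fin.rev ⟨j / 2, by omega⟩) with hφ
  have hinj : Function.Injective φ := by
    intro i j hij
    simp only [hφ] at hij
    split_ifs at hij <;> simp at hij <;> ext <;> omega
  refine ⟨Equiv.ofBijective φ ((Fintype.bijective_iff_injective_and_card φ).2
    ⟨hinj, by simp; omega⟩), fun A j => ?_⟩
  simp only [Equiv.ofBijective_apply, hφ]
  split_ifs <;> rfl

theorem prod_symplecticEigenvaluesHat {n : ℕ} {A : Matrix (Fin n ⊕ Fin n) (Fin n ⊕ Fin n) ℝ}
    (hA : A.PosDef) : ∏ j, symplecticEigenvaluesHat A j = A.det := by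
  obtain ⟨φ, hφ⟩ := exists_equiv_symplecticEigenvaluesHat n
  rw [(isSymplecticEigenvalues_symplecticEigenvalues hA).det_eq, ← φ.prod_comp]
  exact Finset.prod_congr rfl fun j _ => hφ A j

theorem prod_symplecticEigenvaluesHat_matrixRpow_le {n : ℕ}
    {A : Matrix (Fin n ⊕ Fin n) (Fin n ⊕ Fin n) ℝ} (hA : A.PosDef) {t : ℝ} (ht0 : 0 ≤ t)
    (ht1 : t ≤ 1) {k : ℕ} (hk : k ≤ 2 * n) :
    ∏ j : Fin (2 * n) with j.val < k, symplecticEigenvaluesHat (matrixRpow A t) j ≤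
      (∏ j : Fin (2 * n) with j.val < k, symplecticEigenvaluesHat A j) ^ t := by
  obtain ⟨φ, hφ⟩ := exists_equiv_symplecticEigenvaluesHat n
  rw [← prod_castLE_eq_prod_filter_lt hk]
  simp only [hφ (matrixRpow A t)]
  refine IsSymplecticEigenvalues.prod_le_rpow hA ht0 ht1
    (isSymplecticEigenvalues_symplecticEigenvalues hA)
    (isSymplecticEigenvalues_symplecticEigenvalues (hA.posDef_matrixRpow t))
    (Finset.prod_nonneg fun j _ => (symplecticEigenvaluesHat_pos hA j).le) (fun f hf => ?_)
    (g := fun i => φ (Fin.castLE hk i)) (φ.injective.comp (Fin.castLE_injective hk))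
  have := prod_comp_le_prod_filter_lt hk (antitone_symplecticEigenvaluesHat hA)
    (symplecticEigenvaluesHat_pos hA) (f := fun i => φ.symm (f i)) (φ.symm.injective.comp hf)
  simpa [hφ] using this

theorem theorem1 (n : ℕ) (A : Matrix (Fin n ⊕ Fin n) (Fin n ⊕ Fin n) ℝ) (hA : A.PosDef) :
    (∀ t : ℝ, 0 ≤ t → t ≤ 1 →
      LogMajorized (symplecticEigenvaluesHat (matrixRpow A t))
        (fun j => symplecticEigenvaluesHat A j ^ t)) ∧
    (∀ t : ℝ, 1 ≤ t →
      LogMajorized (fun j => symplecticEigenvaluesHat A j ^ t)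
        (symplecticEigenvaluesHat (matrixRpow A t))) := by
  have hpos := symplecticEigenvaluesHat_pos hA
  have hanti : ∀ {t : ℝ}, 0 ≤ t → Antitone fun j => symplecticEigenvaluesHat A j ^ t :=
    fun ht i j hij => Real.rpow_le_rpow (hpos j).le (antitone_symplecticEigenvaluesHat hA hij) ht
  -- Both sides equal `det (A^t) = (det A)^t`; no restriction on `t` is needed.
  have hprod : ∀ t : ℝ, ∏ j, symplecticEigenvaluesHat (matrixRpow A t) j =
      ∏ j, symplecticEigenvaluesHat A j ^ t := fun t => by
    rw [prod_symplecticEigenvaluesHat (hA.posDef_matrixRpow t), hA.det_matrixRpow,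
      ← prod_symplecticEigenvaluesHat hA, Real.finsetProd_rpow _ _ fun j _ => (hpos j).le]
  refine ⟨fun t ht0 ht1 => ?_, fun t ht1 => ?_⟩
  · have hP := hA.posDef_matrixRpow t
    rw [LogMajorized, decreasingRearrangement_eq_self (antitone_symplecticEigenvaluesHat hP),
      decreasingRearrangement_eq_self (hanti ht0)]
    refine ⟨symplecticEigenvaluesHat_pos hP, fun j => Real.rpow_pos_of_pos (hpos j) t,
      fun k _ hk => ?_, hprod t⟩
    rw [Real.finsetProd_rpow _ _ fun j _ => (hpos j).le]
    exact prod_symplecticEigenvaluesHat_matrixRpow_le hA ht0 ht1 hk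
  · have ht0 : 0 < t := by linarith
    have hP := hA.posDef_matrixRpow t
    rw [LogMajorized, decreasingRearrangement_eq_self (antitone_symplecticEigenvaluesHat hP),
      decreasingRearrangement_eq_self (hanti ht0.le)]
    refine ⟨fun j => Real.rpow_pos_of_pos (hpos j) t, symplecticEigenvaluesHat_pos hP,
      fun k _ hk => ?_, (hprod t).symm⟩
    -- The first case for `A^t` with exponent `1/t` bounds the products for `(A^t)^(1/t) = A`;
    -- raising to the power `t` reverses the roles.
    have h := prod_symplecticEigenvaluesHat_matrixRpow_le hP (inv_nonneg.2 ht0.le)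
      (inv_le_one_of_one_le₀ ht1) hk
    rw [hA.matrixRpow_matrixRpow, mul_inv_cancel₀ ht0.ne', hA.matrixRpow_one] at h
    rw [Real.finsetProd_rpow _ _ fun j _ => (hpos j).le]
    have h0 : 0 ≤ ∏ j : Fin (2 * n) with j.val < k, symplecticEigenvaluesHat (matrixRpow A t) j :=
      Finset.prod_nonneg fun j _ => (symplecticEigenvaluesHat_pos hP j).le
    refine (Real.rpow_le_rpow (Finset.prod_nonneg fun j _ => (hpos j).le) h ht0.le).trans_eq ?_
    rw [← Real.rpow_mul h0, inv_mul_cancel₀ ht0.ne', Real.rpow_one]
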